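/- A \emph{partially-commutative grammar} over a finite alphabet consists of a finite set $V$ of non-terminals with an initial $S\in V$, finitely many productions $X \xrightarrow{a} \alpha$ ($X\in V$, $a$ a letter, $\alpha\in V^*$), and a symmetric irreflexive independence relation $I\subseteq V\times V$; its complement $D=(V\times V)\setminus I$ is called dependence. Configurations are words over $V$. A production step replaces $X\beta$ by $\alpha\beta$ and emits $a$, for a production $X\xrightarrow{a}\alpha$; a swap step replaces $\alpha XY\beta$ by $\alpha YX\beta$ when $(X,Y)\in I$, and emits nothing. The language of the grammar consists of the words emitted along sequences of steps from the configuration $S$ to the empty configuration. $\mathrm{PCCFL}$ is the class of languages of such grammars, $\mathrm{trPCCFL}$ the subclass where $D$ can be chosen transitive, and $\mathrm{CCFL}$ the subclass where any two distinct non-terminals can be chosen independent. $L_1\,\|\,L_2$ denotes the shuffle, i.e. the set of all interleavings of a word of $L_1$ with a word of $L_2$. 1. Neither $\mathrm{PCCFL}$ nor $\mathrm{trPCCFL}$ is closed under intersection with regular languages. In particular, the language $L=\{w\in\{a,b,c\}^* : \#_a(w)=\#_b(w)=\#_c(w)\ge 1\}$ belongs to $\mathrm{CCFL}$ and to $\mathrm{trPCCFL}$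 (hence to $\mathrm{PCCFL}$), the language $a^*b^*c^*$ is regular, and $L\cap a^*b^*c^*=\{a^nb^nc^n : n\ge 1\}$ is not in $\mathrm{PCCFL}$. 2. Neither $\mathrm{PCCFL}$ nor $\mathrm{trPCCFL}$ is closed under inverse images of homomorphisms, even of homomorphisms that map no letter to the empty word. In particular, over the alphabet $\{A,S_1,B_1,T_1,S_2,B_2,T_2,C\}$ the languages $L_1=\{A^{n+1}S_1B_1^nT_1 : n\ge 1\}$ and $L_2=\{S_2B_2^nT_2C^n : n\ge 1\}$ are context-free, their shuffle $L_1\,\|\,L_2$ is in $\mathrm{trPCCFL}$ (hence in $\mathrm{PCCFL}$), and for the homomorphism $h(a)=A$, $h(s)=S_1S_2$, $h(b)=B_1B_2$, $h(t)=T_1T_2$, $h(c)=C$ the inverse image $h^{-1}(L_1\,\|\,L_2)=\{a^{n+1}sb^ntc^n : n\ge 1\}$ is not in $\mathrm{PCCFL}$. -/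

import Mathlib

namespace PartiallyCommutative

/-- A context-free grammar in Greibach form over the alphabet `T`, with finitely many
non-terminals, finitely many productions `X →[a] α` (represented as the triple `(X, a, α)`), and a
symmetric, irreflexive independence relation on the non-terminals. -/
structure Grammar (T : Type) where
  /-- The non-terminals. -/
  NT : Type
  finite_NT : Finite NT
  /-- The initial non-terminal. -/
  initial : NT
  /-- The productions. -/
  productions : Set (NT × T × List NT)
  finite_productions : productions.Finite
  /-- The independence relation. -/
  Indep : NT → NT → Prop
  indep_symm : ∀ X Y, Indep X Y → Indep Y X
  indep_irrefl : ∀ X, ¬ Indep X X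

namespace Grammar

variable {T : Type}

/-- Dependence is the complement of independence. -/
def Dep (G : Grammar T) (X Y : G.NT) : Prop := ¬ G.Indep X Y

/-- `G.Derives α w β`: the configuration `β` can be reached from the configuration `α` by a
sequence of production steps and swap steps that defines the word `w`. -/
inductive Derives (G : Grammar T) : List G.NT → List T → List G.NT → Prop
  | refl (α : List G.NT) : Derives G α [] α
  | production {X : G.NT} {a : T} {γ β δ : List G.NT} {w : List T} :
      (X, a, γ) ∈ G.productions → Derives G (γ ++ β) w δ → Derives G (X :: β) (a :: w) δ
  | swap {X Y : G.NT} {α β δ : List G.NT} {w : List T} :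
      G.Indep X Y → Derives G (α ++ Y :: X :: β) w δ → Derives G (α ++ X :: Y :: β) w δ

/-- The words generated by the initial non-terminal. -/
def language (G : Grammar T) : Language T := {w | G.Derives [G.initial] w []}

end Grammar

/-- The partially-commutative context-free languages. -/
def PCCFL (T : Type) : Set (Language T) := {L | ∃ G : Grammar T, G.language = L}

/-- The partially-commutative context-free languages with transitive dependence. -/
def TrPCCFL (T : Type) : Set (Language T) :=
  {L | ∃ G : Grammar T, (∀ X Y Z, G.Dep X Y → G.Dep Y Z → G.Dep X Z) ∧ G.language = L}

/-- The commutative context-free languages: any two distinct non-terminals are independent. -/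
def CCFL (T : Type) : Set (Language T) :=
  {L | ∃ G : Grammar T, (∀ X Y, X ≠ Y → G.Indep X Y) ∧ G.language = L}

/-- The class `C` is closed under intersection with regular languages (over finite alphabets). -/
def ClosedUnderInterRegular (C : (T : Type) → Set (Language T)) : Prop :=
  ∀ (T : Type) [Finite T] (L R : Language T), L ∈ C T → R.IsRegular → L ⊓ R ∈ C T

/-- The inverse image of `L` under the monoid homomorphism from words over `T` to words over `U`
that extends `h : T → List U`. -/
def inverseImage {T U : Type} (h : T → List U) (L : Language U) : Language T :=
  {w | w.flatMap h ∈ L}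

/-- The class `C` is closed under inverse images of homomorphisms that map no letter to the empty
word (over finite alphabets). -/
def ClosedUnderInverseHom (C : (T : Type) → Set (Language T)) : Prop :=
  ∀ (T U : Type) [Finite T] [Finite U] (h : T → List U), (∀ a, h a ≠ []) →
    ∀ L : Language U, L ∈ C U → inverseImage h L ∈ C T

/-- `Interleaving w v u`: the word `u` is an interleaving of the words `w` and `v`. -/
inductive Interleaving {T : Type} : List T → List T → List T → Prop
  | nil : Interleaving [] [] []
  | left {w v u : List T} (a : T) : Interleaving w v u → Interleaving (a :: w) v (a :: u)
  | right {w v u : List T} (a : T) : Interleaving w v u → Interleaving w (a :: v) (a :: u)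

/-- The shuffle `L ‖ K` of two languages. -/
def shuffle {T : Type} (L K : Language T) : Language T :=
  {u | ∃ w ∈ L, ∃ v ∈ K, Interleaving w v u}

/-- A three-letter alphabet. -/
inductive ABC
  | a | b | c
  deriving DecidableEq

/-- The nonempty words with equally many occurrences of each of `a`, `b`, `c`. -/
def equalCounts : Language ABC :=
  {w | w ≠ [] ∧ w.count ABC.a = w.count ABC.b ∧ w.count ABC.b = w.count ABC.c}

open Computability in
/-- The regular language `a* b* c*`. -/
def aStarBStarCStar : Language ABC :=
  ({[ABC.a]} : Language ABC)∗ * ({[ABC.b]} : Language ABC)∗ * ({[ABC.c]} : Language ABC)∗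

/-- The source alphabet of the homomorphism `hom`. -/
inductive Src
  | a | s | b | t | c

/-- The target alphabet of the homomorphism `hom`. -/
inductive Tgt
  | A | S₁ | B₁ | T₁ | S₂ | B₂ | T₂ | C

/-- `{Aⁿ⁺¹ S₁ B₁ⁿ T₁ : n ≥ 1}` -/
def lang₁ : Language Tgt :=
  {w | ∃ n : ℕ, 1 ≤ n ∧
    w = List.replicate (n + 1) Tgt.A ++ [Tgt.S₁] ++ List.replicate n Tgt.B₁ ++ [Tgt.T₁]}

/-- `{S₂ B₂ⁿ T₂ Cⁿ : n ≥ 1}` -/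
def lang₂ : Language Tgt :=
  {w | ∃ n : ℕ, 1 ≤ n ∧
    w = [Tgt.S₂] ++ List.replicate n Tgt.B₂ ++ [Tgt.T₂] ++ List.replicate n Tgt.C}

/-- The homomorphism `a ↦ A`, `s ↦ S₁S₂`, `b ↦ B₁B₂`, `t ↦ T₁T₂`, `c ↦ C`. -/
def hom : Src → List Tgt
  | .a => [.A]
  | .s => [.S₁, .S₂]
  | .b => [.B₁, .B₂]
  | .t => [.T₁, .T₂]
  | .c => [.C]

end PartiallyCommutative

/-!
Swap steps only permute the letters of the emitted word, so every word of a partially-commutative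
context-free language is a permutation of a word that has a derivation without swaps. If the word is
long, a non-terminal encloses itself in this derivation, and pumping yields `u₁ uⁿ x vⁿ v₁` in the
language for all `n`. If all words of the language are sorted with respect to an order of the
letters, then `u` and `v` are powers of single letters. Hence one of any three letters occurs in
neither of them, and the number of its occurrences cannot determine the words of the language.
This excludes `aⁿbⁿcⁿ` and `aⁿ⁺¹sbⁿtcⁿ`.

Equal counts are generated by a commutative grammar in which the initial non-terminal emits the
first letter of a round and leaves behind a non-terminal for each of the other letters. A shuffle is
generated by the union of two grammars in which the non-terminals of one are independent of those of
the other.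
-/

namespace PartiallyCommutative

namespace Grammar

variable {T : Type} {G H : Grammar T}

/-! ### Derivations -/

theorem Derives.trans {α β δ : List G.NT} {u v : List T} (h : G.Derives α u β)
    (h' : G.Derives β v δ) : G.Derives α (u ++ v) δ := by
  induction h with
  | refl => exact h'
  | production hp _ ih => exact .production hp (ih h')
  | swap hXY _ ih => exact .swap hXY (ih h')

theorem Derives.append_right {α β : List G.NT} {w : List T} (h : G.Derives α w β)
    (ρ : List G.NT) : G.Derives (α ++ ρ) w (β ++ ρ) := by
  induction h with
  | refl => exact .refl _
  | production hp _ ih => exact .production hp (by simpa using ih)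
  | @swap X Y α β _ _ hXY _ ih => simpa using Derives.swap (β := β ++ ρ) hXY (by simpa using ih)

/-- Only swap steps can be performed behind a nonempty prefix, hence the empty word. -/
theorem Derives.append_left {α β : List G.NT} (h : G.Derives α [] β) (π : List G.NT) :
    G.Derives (π ++ α) [] (π ++ β) := by
  generalize hw : [] = w at h
  induction h with
  | refl => exact .refl _
  | production => cases hw
  | @swap X Y α β _ _ hXY _ ih =>
    simpa using Derives.swap (α := π ++ α) hXY (by simpa using ih hw)

theorem Derives.perm {α β : List G.NT} (h : G.Derives α [] β) : α.Perm β := by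
  generalize hw : [] = w at h
  induction h with
  | refl => rfl
  | production => cases hw
  | swap _ _ ih => exact ((List.Perm.swap ..).append_left _).trans (ih hw)

theorem derives_cons_iff {α δ : List G.NT} {a : T} {w : List T} :
    G.Derives α (a :: w) δ ↔ ∃ X β γ, G.Derives α [] (X :: β) ∧ (X, a, γ) ∈ G.productions ∧
      G.Derives (γ ++ β) w δ := by
  constructor
  · intro h
    generalize hv : a :: w = v at h
    induction h with
    | refl => cases hv
    | production hp h =>
      cases hv
      exact ⟨_, _, _, .refl _, hp, h⟩
    | swap hXY _ ih =>
      obtain ⟨Z, β, γ, hZ, hp, h⟩ := ih hv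
      exact ⟨Z, β, γ, .swap hXY hZ, hp, h⟩
  · rintro ⟨X, β, γ, hX, hp, h⟩
    exact hX.trans (.production hp h)

theorem derives_singleton_nil_iff {X : G.NT} {w : List T} : G.Derives [X] w [] ↔
    ∃ a γ u, (X, a, γ) ∈ G.productions ∧ G.Derives γ u [] ∧ w = a :: u := by
  constructor
  · intro h
    obtain _ | ⟨a, u⟩ := w
    · exact absurd h.perm.eq_nil (List.cons_ne_nil _ _)
    · obtain ⟨Y, β, γ, hY, hp, h⟩ := derives_cons_iff.1 h
      obtain ⟨rfl, rfl⟩ := List.cons_eq_cons.1 (List.perm_singleton.1 hY.perm.symm)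
      exact ⟨a, γ, u, hp, by simpa using h, rfl⟩
  · rintro ⟨a, γ, u, hp, h, rfl⟩
    exact .production hp (by simpa using h)

theorem derives_cons_append_singleton {X : G.NT} {β : List G.NT} (h : ∀ Y ∈ β, G.Indep X Y) :
    G.Derives (X :: β) [] (β ++ [X]) := by
  induction β with
  | nil => exact .refl _
  | cons Y β ih =>
    obtain ⟨hY, hβ⟩ := List.forall_mem_cons.1 h
    exact .swap (α := []) hY ((ih hβ).append_left [Y])

theorem derives_append_comm {α β : List G.NT} (h : ∀ X ∈ α, ∀ Y ∈ β, G.Indep X Y) :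
    G.Derives (α ++ β) [] (β ++ α) := by
  induction α with
  | nil => simpa using Derives.refl β
  | cons X α ih =>
    obtain ⟨hX, hα⟩ := List.forall_mem_cons.1 h
    have hmove := (derives_cons_append_singleton hX).append_right α
    simpa using ((ih hα).append_left [X]).trans hmove

theorem derives_of_perm (hG : ∀ X Y, X ≠ Y → G.Indep X Y) {α β : List G.NT} (h : α.Perm β) :
    G.Derives α [] β := by
  induction h with
  | nil => exact .refl _
  | cons X _ ih => exact ih.append_left [X]
  | swap X Y α =>
    by_cases hYX : Y = X
    · exact hYX ▸ .refl _
    · exact .swap (α := []) (hG _ _ hYX) (.refl _)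
  | trans _ _ ih ih' => exact ih.trans ih'

theorem Derives.filterMap {f : G.NT → Option H.NT}
    (hf : ∀ X Y, G.Indep X Y → ∀ X' ∈ f X, ∀ Y' ∈ f Y, H.Indep X' Y') {α β : List G.NT}
    (h : G.Derives α [] β) : H.Derives (α.filterMap f) [] (β.filterMap f) := by
  generalize hw : [] = w at h
  induction h with
  | refl => exact .refl _
  | production => cases hw
  | @swap X Y α β _ _ hXY _ ih =>
    suffices hstep : H.Derives ((α ++ X :: Y :: β).filterMap f) []
        ((α ++ Y :: X :: β).filterMap f) from hstep.trans (ih hw)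
    simp only [List.filterMap_append, List.filterMap_cons]
    cases hX : f X with
    | none => exact .refl _
    | some X' =>
      cases hY : f Y with
      | none => exact .refl _
      | some Y' => exact .swap (hf X Y hXY X' hX Y' hY) (.refl _)

/-! ### Leftmost derivations -/

/-- `G.Yields α w`: the word `w` is emitted by a derivation without swaps from `α` to the empty
configuration. In such a derivation every non-terminal of `α` emits a factor of `w`; this splitting
is built into the definition. -/
inductive Yields (G : Grammar T) : List G.NT → List T → Prop
  | nil : Yields G [] []
  | cons {X : G.NT} {a : T} {γ β : List G.NT} {u v : List T} :
      (X, a, γ) ∈ G.productions → Yields G γ u → Yields G β v → Yields G (X :: β) (a :: (u ++ v))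

theorem Yields.append {α β : List G.NT} {u v : List T} (hα : G.Yields α u) (hβ : G.Yields β v) :
    G.Yields (α ++ β) (u ++ v) := by
  induction hα with
  | nil => exact hβ
  | cons hp hγ _ _ ih => simpa using Yields.cons hp hγ ih

theorem yields_nil_iff {w : List T} : G.Yields [] w ↔ w = [] :=
  ⟨fun | .nil => rfl, fun h => h ▸ .nil⟩

theorem yields_append_iff {α β : List G.NT} {w : List T} :
    G.Yields (α ++ β) w ↔ ∃ u v, G.Yields α u ∧ G.Yields β v ∧ w = u ++ v := by
  constructor
  · intro h
    induction α generalizing w with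
    | nil => exact ⟨[], w, .nil, h, rfl⟩
    | cons X α ih =>
      cases h with
      | cons hp hγ hβ =>
        obtain ⟨u, v, hu, hv, rfl⟩ := ih hβ
        exact ⟨_, v, .cons hp hγ hu, hv, by simp⟩
  · rintro ⟨u, v, hu, hv, rfl⟩
    exact hu.append hv

theorem yields_cons_iff {X : G.NT} {β : List G.NT} {w : List T} :
    G.Yields (X :: β) w ↔ ∃ u v, G.Yields [X] u ∧ G.Yields β v ∧ w = u ++ v :=
  yields_append_iff (α := [X])

theorem yields_singleton_iff {X : G.NT} {w : List T} :
    G.Yields [X] w ↔ ∃ a γ u, (X, a, γ) ∈ G.productions ∧ G.Yields γ u ∧ w = a :: u := by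
  constructor
  · rintro (_ | ⟨hp, hγ, ⟨⟩⟩)
    exact ⟨_, _, _, hp, hγ, by simp⟩
  · rintro ⟨a, γ, u, hp, hu, rfl⟩
    simpa using Yields.cons hp hu .nil

theorem Yields.derives {α : List G.NT} {w : List T} (h : G.Yields α w) : G.Derives α w [] := by
  induction h with
  | nil => exact .refl _
  | @cons X a γ β _ _ hp _ _ ihγ ihβ => exact .production hp ((ihγ.append_right β).trans ihβ)

theorem Yields.of_append_comm {π α β ρ : List G.NT} {w : List T}
    (h : G.Yields (π ++ (α ++ (β ++ ρ))) w) :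
    ∃ w', w'.Perm w ∧ G.Yields (π ++ (β ++ (α ++ ρ))) w' := by
  obtain ⟨p, _, hp, hαβρ, rfl⟩ := yields_append_iff.1 h
  obtain ⟨u, _, hu, hβρ, rfl⟩ := yields_append_iff.1 hαβρ
  obtain ⟨v, r, hv, hr, rfl⟩ := yields_append_iff.1 hβρ
  refine ⟨p ++ (v ++ (u ++ r)), ?_, hp.append (hv.append (hu.append hr))⟩
  have hvu : (v ++ u ++ r).Perm (u ++ v ++ r) := List.perm_append_comm.append_right r
  simpa only [List.append_assoc] using hvu.append_left p

/-- Swapping two non-terminals only permutes the factors they emit. -/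
theorem Derives.exists_perm_yields {α β : List G.NT} {u v : List T} (h : G.Derives α u β)
    (hβ : G.Yields β v) : ∃ w, w.Perm (u ++ v) ∧ G.Yields α w := by
  induction h with
  | refl => exact ⟨v, .refl _, hβ⟩
  | production hp _ ih =>
    obtain ⟨w, hw, hγβ⟩ := ih hβ
    obtain ⟨x, y, hx, hy, rfl⟩ := yields_append_iff.1 hγβ
    exact ⟨_, hw.cons _, .cons hp hx hy⟩
  | @swap X Y α β _ _ _ _ ih =>
    obtain ⟨w, hw, hy⟩ := ih hβ
    obtain ⟨w', hw', hy'⟩ := Yields.of_append_comm (α := [Y]) (β := [X]) hy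
    exact ⟨w', hw'.trans hw, hy'⟩

theorem Derives.yields (hG : ∀ X Y, ¬ G.Indep X Y) {α β : List G.NT} {u v : List T}
    (h : G.Derives α u β) (hβ : G.Yields β v) : G.Yields α (u ++ v) := by
  induction h with
  | refl => exact hβ
  | production hp _ ih =>
    obtain ⟨x, y, hx, hy, hxy⟩ := yields_append_iff.1 (ih hβ)
    rw [List.cons_append, hxy]
    exact .cons hp hx hy
  | swap hXY => exact (hG _ _ hXY).elim

theorem derives_nil_iff_yields (hG : ∀ X Y, ¬ G.Indep X Y) {α : List G.NT} {w : List T} :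
    G.Derives α w [] ↔ G.Yields α w :=
  ⟨fun h => by simpa using h.yields hG .nil, Yields.derives⟩

/-- The yields form the least family of languages that is closed under the productions. -/
theorem Yields.mem_prod {α : List G.NT} {w : List T} (h : G.Yields α w) (K : G.NT → Language T)
    (hK : ∀ X a γ, (X, a, γ) ∈ G.productions → ∀ u ∈ (γ.map K).prod, a :: u ∈ K X) :
    w ∈ (α.map K).prod := by
  induction h with
  | nil => exact Language.nil_mem_one
  | cons hp _ _ ihγ ihβ =>
    rw [List.map_cons, List.prod_cons]
    exact Language.append_mem_mul (hK _ _ _ hp _ ihγ) ihβ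

/-! ### Pumping -/

/-- `G.Context X Y u v`: the non-terminal `X` leads to `u Y v` in a leftmost derivation. This is
expressed through the words that it yields, so that no sentential forms are needed. -/
def Context (G : Grammar T) (X Y : G.NT) (u v : List T) : Prop :=
  ∀ x, G.Yields [Y] x → G.Yields [X] (u ++ x ++ v)

theorem Context.trans {X Y Z : G.NT} {u v u' v' : List T} (h : G.Context X Y u v)
    (h' : G.Context Y Z u' v') : G.Context X Z (u ++ u') (v' ++ v) :=
  fun x hx => by simpa using h _ (h' x hx)

theorem Context.flatten_replicate {X : G.NT} {u v : List T} (h : G.Context X X u v) (n : ℕ) :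
    G.Context X X (List.replicate n u).flatten (List.replicate n v).flatten := by
  induction n with
  | zero => exact fun x hx => by simpa using hx
  | succ n ih =>
    rw [List.replicate_succ, List.replicate_succ' (a := v)]
    simpa using h.trans ih

/-- `G.Encloses (X, w) (Y, x)`: a leftmost derivation from `X` to `w` passes through `Y`, from which
it derives the factor `x` of `w`, and `w` has at least one letter in front of this factor. -/
def Encloses (G : Grammar T) (p q : G.NT × List T) : Prop :=
  ∃ u v, u ≠ [] ∧ p.2 = u ++ q.2 ++ v ∧ G.Context p.1 q.1 u v

instance (G : Grammar T) : IsTrans (G.NT × List T) G.Encloses where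
  trans := by
    rintro ⟨X, _⟩ ⟨Y, _⟩ ⟨Z, x⟩ ⟨u, v, hu, rfl, hXY⟩ ⟨u', v', -, rfl, hYZ⟩
    exact ⟨u ++ u', v' ++ v, by simp [hu], by simp, hXY.trans hYZ⟩

theorem Yields.exists_long_factor {α : List G.NT} {w : List T} (h : G.Yields α w) {b : ℕ}
    (hw : α.length * b < w.length) : ∃ Z u x v, b < x.length ∧ G.Yields [Z] x ∧ w = u ++ x ++ v ∧
      ∀ x', G.Yields [Z] x' → G.Yields α (u ++ x' ++ v) := by
  induction α generalizing w with
  | nil => simp [yields_nil_iff.1 h] at hw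
  | cons X α ih =>
    obtain ⟨x, v, hx, hv, rfl⟩ := yields_cons_iff.1 h
    by_cases hb : b < x.length
    · exact ⟨X, [], x, v, hb, hx, rfl, fun x' hx' => hx'.append hv⟩
    · have hlen : α.length * b < v.length := by
        rw [List.length_cons, add_one_mul, List.length_append] at hw
        omega
      obtain ⟨Z, u, y, v', hy, hZ, rfl, hc⟩ := ih hv hlen
      exact ⟨Z, x ++ u, y, v', hy, hZ, by simp, fun x' hx' => by simpa using hx.append (hc x' hx')⟩

theorem exists_production_length_le (G : Grammar T) :
    ∃ r, ∀ X a γ, (X, a, γ) ∈ G.productions → γ.length ≤ r := by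
  obtain ⟨r, hr⟩ := (G.finite_productions.image fun p => p.2.2.length).bddAbove
  exact ⟨r, fun X a γ h => hr ⟨_, h, rfl⟩⟩

theorem exists_isChain_encloses (G : Grammar T) (n : ℕ) :
    ∃ b, ∀ X w, G.Yields [X] w → b < w.length → ∃ l : List (G.NT × List T), l.length = n ∧
      ((X, w) :: l).IsChain G.Encloses ∧ ∀ p ∈ l, G.Yields [p.1] p.2 := by
  obtain ⟨r, hr⟩ := G.exists_production_length_le
  induction n with
  | zero => exact ⟨0, fun X w _ _ => ⟨[], rfl, .singleton _, by simp⟩⟩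
  | succ n ih =>
    obtain ⟨b, hb⟩ := ih
    refine ⟨r * b + 1, fun X w hw hlen => ?_⟩
    obtain ⟨a, γ, w, hp, hγ, rfl⟩ := yields_singleton_iff.1 hw
    have hγlen : γ.length * b < w.length :=
      (Nat.mul_le_mul_right b (hr X a γ hp)).trans_lt (by simpa using hlen)
    obtain ⟨Z, u, x, v, hx, hZ, rfl, hc⟩ := hγ.exists_long_factor hγlen
    have hXZ : G.Encloses (X, a :: (u ++ x ++ v)) (Z, x) :=
      ⟨a :: u, v, by simp, rfl, fun x' hx' => yields_singleton_iff.2 ⟨a, γ, _, hp, hc x' hx', rfl⟩⟩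
    obtain ⟨l, hl, hchain, hyields⟩ := hb Z x hZ hx
    exact ⟨(Z, x) :: l, by simp [hl], .cons_cons hXZ hchain, List.forall_mem_cons.2 ⟨hZ, hyields⟩⟩

/-- By the pigeonhole principle, two members of a long chain have the same non-terminal. -/
theorem exists_pumping (G : Grammar T) : ∃ b, ∀ X w, G.Yields [X] w → b < w.length →
    ∃ u₁ u x v v₁, u ≠ [] ∧ w = u₁ ++ u ++ x ++ v ++ v₁ ∧ ∀ n, G.Yields [X]
      (u₁ ++ (List.replicate n u).flatten ++ x ++ (List.replicate n v).flatten ++ v₁) := by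
  have := G.finite_NT
  have := Fintype.ofFinite G.NT
  obtain ⟨b, hb⟩ := G.exists_isChain_encloses (Fintype.card G.NT + 1)
  refine ⟨b, fun X w hw hlen => ?_⟩
  obtain ⟨l, hl, hchain, hyields⟩ := hb X w hw hlen
  obtain ⟨hX, hpair⟩ := List.pairwise_cons.1 hchain.pairwise
  obtain ⟨p, hp, q, hq, hpq, heq⟩ : ∃ p ∈ l, ∃ q ∈ l, G.Encloses p q ∧ p.1 = q.1 := by
    by_contra! hne
    have hnodup : (l.map Prod.fst).Nodup :=
      List.pairwise_map.2 (hpair.imp_of_mem fun hp hq hpq => hne _ hp _ hq hpq)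
    have := hnodup.length_le_card
    rw [List.length_map] at this
    omega
  obtain ⟨Y, x'⟩ := p
  obtain ⟨_, x⟩ := q
  obtain rfl : Y = _ := heq
  obtain ⟨u₁, v₁, -, rfl, hXY⟩ := hX _ hp
  obtain ⟨u, v, hu, rfl, hYY⟩ := hpq
  refine ⟨u₁, u, x, v, v₁, hu, by simp, fun n => ?_⟩
  simpa using hXY _ (hYY.flatten_replicate n x (hyields _ hq))

end Grammar

/-! ### Languages outside `PCCFL` -/

theorem exists_pumping_of_mem_PCCFL {T : Type} {L : Language T} (hL : L ∈ PCCFL T) :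
    ∃ b, ∀ w ∈ L, b < w.length → ∃ u₁ u x v v₁, u ≠ [] ∧ (u₁ ++ u ++ x ++ v ++ v₁).Perm w ∧
      ∀ n, u₁ ++ (List.replicate n u).flatten ++ x ++ (List.replicate n v).flatten ++ v₁ ∈ L := by
  obtain ⟨G, rfl⟩ := hL
  obtain ⟨b, hb⟩ := G.exists_pumping
  refine ⟨b, fun w hw hlen => ?_⟩
  obtain ⟨w', hperm, hw'⟩ := Grammar.Derives.exists_perm_yields hw .nil
  rw [List.append_nil] at hperm
  obtain ⟨u₁, u, x, v, v₁, hu, rfl, hpump⟩ := hb _ w' hw' (hperm.length_eq ▸ hlen)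
  exact ⟨u₁, u, x, v, v₁, hu, hperm, fun n => (hpump n).derives⟩

theorem eq_of_mem_of_pairwise_append_self {T : Type*} {r : T → T → Prop} [Std.Antisymm r]
    {u : List T} (h : (u ++ u).Pairwise r) {p q : T} (hp : p ∈ u) (hq : q ∈ u) : p = q :=
  have hr := (List.pairwise_append.1 h).2.2
  antisymm (hr p hp q hq) (hr q hq p hp)

/-- A pumped factor of a sorted word is a power of a single letter, so at least one of any three
letters does not occur in the two factors that are pumped. -/
theorem notMem_PCCFL_of_pairwise {T : Type} [DecidableEq T] {r : T → T → Prop} [Std.Antisymm r]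
    {L : Language T} (hr : ∀ w ∈ L, w.Pairwise r)
    {S : Finset T} (hS : 2 < S.card) (hcount : ∀ t ∈ S, Set.InjOn (List.count t) L)
    (hlong : ∀ n, ∃ w ∈ L, n < w.length) : L ∉ PCCFL T := by
  intro hL
  obtain ⟨b, hb⟩ := exists_pumping_of_mem_PCCFL hL
  obtain ⟨w, hw, hlen⟩ := hlong b
  obtain ⟨u₁, u, x, v, v₁, hu, -, hpump⟩ := hb w hw hlen
  have hmem₁ : u₁ ++ u ++ x ++ v ++ v₁ ∈ L := by simpa using hpump 1
  have hmem₂ : u₁ ++ (u ++ u) ++ x ++ (v ++ v) ++ v₁ ∈ L := by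
    simpa [List.replicate_succ] using hpump 2
  have hcover : S ⊆ u.toFinset ∪ v.toFinset := by
    intro t ht
    by_contra hnot
    simp only [Finset.mem_union, List.mem_toFinset, not_or] at hnot
    have heq := hcount t ht hmem₁ hmem₂ <| by
      simp [List.count_append, List.count_eq_zero_of_not_mem hnot.1,
        List.count_eq_zero_of_not_mem hnot.2]
    have hlen_eq := congrArg List.length heq
    have hu_pos := List.length_pos_iff.2 hu
    simp only [List.length_append] at hlen_eq
    omega
  have hsorted := hr _ hmem₂
  have hone {y : List T} (hy : y ++ y <:+: u₁ ++ (u ++ u) ++ x ++ (v ++ v) ++ v₁) :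
      y.toFinset.card ≤ 1 :=
    Finset.card_le_one.2 fun p hp q hq => eq_of_mem_of_pairwise_append_self
      (hsorted.sublist hy.sublist) (List.mem_toFinset.1 hp) (List.mem_toFinset.1 hq)
  have hu_one : u.toFinset.card ≤ 1 := hone ⟨u₁, x ++ (v ++ v) ++ v₁, by simp⟩
  have hv_one : v.toFinset.card ≤ 1 := hone ⟨u₁ ++ (u ++ u) ++ x, v₁, rfl⟩
  have := (Finset.card_le_card hcover).trans (Finset.card_union_le _ _)
  omega

theorem CCFL_subset_TrPCCFL {T : Type} : CCFL T ⊆ TrPCCFL T := by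
  rintro _ ⟨G, hG, rfl⟩
  have hdep {X Y : G.NT} (h : G.Dep X Y) : X = Y := of_not_not fun hne => h (hG X Y hne)
  exact ⟨G, fun X Y Z hXY hYZ => hdep hXY ▸ hYZ, rfl⟩

theorem TrPCCFL_subset_PCCFL {T : Type} : TrPCCFL T ⊆ PCCFL T :=
  fun _ ⟨G, _, hG⟩ => ⟨G, hG⟩

/-! ### Words in which all letters occur equally often -/

section UniformCounts

variable {T : Type} [DecidableEq T]

/-- The nonempty words over a finite alphabet in which all letters occur equally often. For three
letters this is `equalCounts`. -/
def uniformCounts (T : Type) [DecidableEq T] : Language T :=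
  {w | w ≠ [] ∧ ∀ s t, w.count s = w.count t}

variable [Fintype T]

/-- The letters different from `t`, in some order. -/
noncomputable def others (t : T) : List T := (Finset.univ.erase t).toList

theorem count_cons_others (s t : T) : (t :: others t).count s = 1 :=
  List.count_eq_one_of_mem (by simp [others, Finset.nodup_toList]) (by simp [others, eq_or_ne])

/-- The commutative grammar for `uniformCounts T`. The initial non-terminal `none` emits the
first letter of a round and releases the non-terminals `some s` of all other letters `s`, each of
which emits its letter once, at any later time. -/
noncomputable abbrev roundGrammar (T : Type) [Fintype T] [DecidableEq T] : Grammar T where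
  NT := Option T
  finite_NT := inferInstance
  initial := none
  productions := (Set.range fun t => (none, t, none :: (others t).map some)) ∪
    (Set.range fun t => (none, t, (others t).map some)) ∪ Set.range fun t => (some t, t, [])
  finite_productions := Set.toFinite _
  Indep := (· ≠ ·)
  indep_symm _ _ := Ne.symm
  indep_irrefl _ h := h rfl

theorem count_of_derives_roundGrammar {α δ : List (roundGrammar T).NT} {w : List T}
    (h : (roundGrammar T).Derives α w δ) :
    ∃ m, ∀ t, w.count t + δ.count (some t) = α.count (some t) + m := by
  have hsome (l : List T) (t : T) : (l.map some).count (some t) = l.count t :=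
    List.count_map_of_injective l some (Option.some_injective T) t
  induction h with
  | refl α => exact ⟨0, by simp⟩
  | @production X a γ β δ w hp _ ih =>
    obtain ⟨m, hcount⟩ := ih
    obtain (⟨_, h⟩ | ⟨_, h⟩) | ⟨_, h⟩ := hp <;> obtain ⟨rfl, rfl, rfl⟩ := h
    iterate 2
      · refine ⟨m + 1, fun s => ?_⟩
        have hround := count_cons_others s a
        specialize hcount s
        simp only [List.count_cons, List.count_append, hsome, beq_iff_eq,
          reduceCtorEq, if_false, add_zero] at hcount hround ⊢
        omega
    · refine ⟨m, fun s => ?_⟩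
      specialize hcount s
      simp only [List.count_cons, List.nil_append, beq_iff_eq, Option.some.injEq] at hcount ⊢
      omega
  | @swap X Y α β _ _ _ _ ih =>
    have hperm : (α ++ X :: Y :: β).Perm (α ++ Y :: X :: β) := (List.Perm.swap ..).append_left α
    simpa only [hperm.count_eq] using ih

theorem derives_map_some_nil (w : List T) : (roundGrammar T).Derives (w.map some) w [] := by
  induction w with
  | nil => exact .refl _
  | cons t w ih => exact .production (.inr ⟨t, rfl⟩) ih

theorem derives_none_cons {n : ℕ} {l w : List T} (hne : w ≠ [])
    (hw : ∀ t, w.count t = l.count t + (n + 1)) :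
    (roundGrammar T).Derives (none :: l.map some) w [] := by
  induction n generalizing l w with
  | zero =>
    obtain ⟨t, w, rfl⟩ := List.exists_cons_of_ne_nil hne
    have hperm : (others t ++ l).Perm w := by
      refine List.perm_iff_count.2 fun s => ?_
      have hs := hw s
      have hround := count_cons_others s t
      simp only [List.count_cons, List.count_append] at hs hround ⊢
      omega
    refine .production (.inl (.inr ⟨t, rfl⟩)) ?_
    rw [← List.map_append]
    exact (Grammar.derives_of_perm (fun _ _ => id) (hperm.map some)).trans (derives_map_some_nil w)
  | succ n ih =>
    obtain ⟨t, w, rfl⟩ := List.exists_cons_of_ne_nil hne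
    have hcount (s : T) : w.count s = (others t ++ l).count s + (n + 1) := by
      have hs := hw s
      have hround := count_cons_others s t
      simp only [List.count_cons, List.count_append] at hs hround ⊢
      omega
    have hmem : t ∈ w := List.count_pos_iff.1 (by rw [hcount]; omega)
    refine .production (.inl (.inl ⟨t, rfl⟩)) ?_
    rw [List.cons_append, ← List.map_append]
    exact ih (List.ne_nil_of_mem hmem) hcount

theorem language_roundGrammar : (roundGrammar T).language = uniformCounts T := by
  ext w
  constructor
  · intro h
    obtain ⟨m, hm⟩ := count_of_derives_roundGrammar h
    refine ⟨?_, fun s t => by simpa using (hm s).trans (hm t).symm⟩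
    rintro rfl
    exact absurd h.perm.eq_nil (List.cons_ne_nil _ _)
  · rintro ⟨hne, hw⟩
    obtain ⟨t, ht⟩ := List.exists_mem_of_ne_nil w hne
    obtain ⟨n, hn⟩ := Nat.exists_eq_add_of_lt (List.count_pos_iff.2 ht)
    exact derives_none_cons (l := []) (n := n) hne fun s => by rw [hw s t, hn]; simp

end UniformCounts

theorem uniformCounts_mem_CCFL (T : Type) [Finite T] [DecidableEq T] : uniformCounts T ∈ CCFL T :=
  have := Fintype.ofFinite T
  ⟨roundGrammar T, fun _ _ => id, language_roundGrammar⟩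

/-! ### Sorted words -/

/-- By the Myhill–Nerode theorem: what may follow `x` depends only on the letters of `x` and on
whether `x` itself is sorted. -/
theorem isRegular_setOf_pairwise {T : Type*} [Finite T] (r : T → T → Prop) :
    Language.IsRegular ({w | w.Pairwise r} : Language T) := by
  let residual (s : Prop × Set T) : Language T :=
    {y | s.1 ∧ y.Pairwise r ∧ ∀ p ∈ s.2, ∀ q ∈ y, r p q}
  refine .of_finite_range_leftQuotient ((Set.finite_range residual).subset ?_)
  rintro _ ⟨x, rfl⟩
  refine ⟨(x.Pairwise r, {p | p ∈ x}), ?_⟩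
  ext y
  exact List.pairwise_append.symm

theorem mem_kstar_singleton {T : Type*} {t : T} {w : List T} :
    w ∈ KStar.kstar ({[t]} : Language T) ↔ ∃ n, w = List.replicate n t := by
  rw [Language.mem_kstar]
  constructor
  · rintro ⟨L, rfl, hL⟩
    refine ⟨L.length, ?_⟩
    rw [List.eq_replicate_of_mem hL, List.flatten_replicate_singleton, List.length_replicate]
  · rintro ⟨n, rfl⟩
    exact ⟨List.replicate n [t], by simp, fun y hy => List.eq_of_mem_replicate hy⟩

instance : Fintype ABC := ⟨{.a, .b, .c}, by rintro ⟨⟩ <;> decide⟩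

/-- Letters are ordered as they are declared: `a < b < c`. -/
instance : PartialOrder ABC :=
  PartialOrder.lift ABC.ctorIdx (by rintro ⟨⟩ ⟨⟩ <;> simp [ABC.ctorIdx])

theorem mem_aStarBStarCStar {w : List ABC} : w ∈ aStarBStarCStar ↔ ∃ i j k,
    w = List.replicate i .a ++ List.replicate j .b ++ List.replicate k .c := by
  simp only [aStarBStarCStar, Language.mem_mul, mem_kstar_singleton]
  constructor
  · rintro ⟨_, ⟨_, ⟨i, rfl⟩, _, ⟨j, rfl⟩, rfl⟩, _, ⟨k, rfl⟩, rfl⟩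
    exact ⟨i, j, k, rfl⟩
  · rintro ⟨i, j, k, rfl⟩
    exact ⟨_, ⟨_, ⟨i, rfl⟩, _, ⟨j, rfl⟩, rfl⟩, _, ⟨k, rfl⟩, rfl⟩

theorem pairwise_replicate_abc (i j k : ℕ) : (List.replicate i ABC.a ++ List.replicate j ABC.b ++
    List.replicate k ABC.c).Pairwise (· ≤ ·) := by
  have hab : ABC.a ≤ .b := Nat.zero_le 1
  have hac : ABC.a ≤ .c := Nat.zero_le 2
  have hbc : ABC.b ≤ .c := Nat.le_succ 1
  simp +contextual [List.pairwise_append, List.pairwise_replicate, List.mem_replicate, or_imp,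
    hab, hac, hbc]

theorem eq_of_pairwise_of_count_eq {T : Type*} [DecidableEq T] [PartialOrder T]
    {v w : List T} (hv : v.Pairwise (· ≤ ·)) (hw : w.Pairwise (· ≤ ·))
    (h : ∀ t, v.count t = w.count t) : v = w :=
  (List.perm_iff_count.2 h).eq_of_pairwise (fun _ _ _ _ => le_antisymm) hv hw

theorem aStarBStarCStar_eq : aStarBStarCStar = {w | w.Pairwise (· ≤ ·)} := by
  ext w
  rw [mem_aStarBStarCStar]
  constructor
  · rintro ⟨i, j, k, rfl⟩
    exact pairwise_replicate_abc i j k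
  · refine fun hw => ⟨w.count .a, w.count .b, w.count .c, ?_⟩
    refine eq_of_pairwise_of_count_eq hw (pairwise_replicate_abc ..) ?_
    rintro ⟨⟩ <;> simp [List.count_replicate]

theorem isRegular_aStarBStarCStar : aStarBStarCStar.IsRegular :=
  aStarBStarCStar_eq ▸ isRegular_setOf_pairwise _

theorem equalCounts_eq_uniformCounts : equalCounts = uniformCounts ABC := by
  ext w
  refine and_congr_right fun _ => ⟨?_, fun h => ⟨h .a .b, h .b .c⟩⟩
  rintro ⟨hab, hbc⟩ (_ | _ | _) (_ | _ | _) <;> omega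

theorem equalCounts_mem_CCFL : equalCounts ∈ CCFL ABC :=
  equalCounts_eq_uniformCounts ▸ uniformCounts_mem_CCFL ABC

theorem equalCounts_inf_aStarBStarCStar : equalCounts ⊓ aStarBStarCStar =
    {w | ∃ n : ℕ, 1 ≤ n ∧ w = List.replicate n ABC.a ++ List.replicate n ABC.b ++
      List.replicate n ABC.c} := by
  ext w
  constructor
  · rintro ⟨⟨hne, hab, hbc⟩, hw⟩
    obtain ⟨i, j, k, rfl⟩ := mem_aStarBStarCStar.1 hw
    obtain rfl : i = j := by simpa [List.count_append, List.count_replicate] using hab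
    obtain rfl : i = k := by simpa [List.count_append, List.count_replicate] using hbc
    refine ⟨i, Nat.one_le_iff_ne_zero.2 ?_, rfl⟩
    rintro rfl
    exact hne rfl
  · rintro ⟨n, hn, rfl⟩
    refine ⟨⟨?_, ?_, ?_⟩, mem_aStarBStarCStar.2 ⟨n, n, n, rfl⟩⟩
    · simp; omega
    · simp [List.count_replicate]
    · simp [List.count_replicate]

theorem equalCounts_inf_aStarBStarCStar_notMem_PCCFL :
    equalCounts ⊓ aStarBStarCStar ∉ PCCFL ABC := by
  have hsorted : ∀ w ∈ equalCounts ⊓ aStarBStarCStar, w.Pairwise (· ≤ ·) := fun w hw =>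
    aStarBStarCStar_eq.le hw.2
  refine notMem_PCCFL_of_pairwise (S := Finset.univ) hsorted (by decide) ?_ fun n => ?_
  · intro t _ v hv w hw (hvw : v.count t = w.count t)
    have hv' := equalCounts_eq_uniformCounts ▸ hv.1
    have hw' := equalCounts_eq_uniformCounts ▸ hw.1
    exact eq_of_pairwise_of_count_eq (hsorted v hv) (hsorted w hw) fun s =>
      (hv'.2 s t).trans (hvw.trans (hw'.2 t s))
  · rw [equalCounts_inf_aStarBStarCStar]
    exact ⟨_, ⟨n + 1, by simp, rfl⟩, by simp; omega⟩

/-! ### Shuffles -/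

namespace Grammar

variable {T : Type} {G₁ G₂ : Grammar T}

/-- A configuration of the first grammar, as a configuration of the shuffle. -/
abbrev inl (α : List G₁.NT) : List (Option (G₁.NT ⊕ G₂.NT)) := α.map fun X => some (.inl X)

/-- A configuration of the second grammar, as a configuration of the shuffle. -/
abbrev inr (β : List G₂.NT) : List (Option (G₁.NT ⊕ G₂.NT)) := β.map fun Y => some (.inr Y)

/-- The non-terminals of the first grammar in a configuration of the shuffle. -/
def projLeft (δ : List (Option (G₁.NT ⊕ G₂.NT))) : List G₁.NT :=
  δ.filterMap (·.bind Sum.getLeft?)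

/-- The non-terminals of the second grammar in a configuration of the shuffle. -/
def projRight (δ : List (Option (G₁.NT ⊕ G₂.NT))) : List G₂.NT :=
  δ.filterMap (·.bind Sum.getRight?)

theorem projLeft_append (δ ε : List (Option (G₁.NT ⊕ G₂.NT))) :
    projLeft (δ ++ ε) = projLeft δ ++ projLeft ε :=
  List.filterMap_append

theorem projLeft_inl (α : List G₁.NT) : projLeft (inl (G₂ := G₂) α) = α := by
  simp [projLeft, List.filterMap_map, Function.comp_def]

theorem projLeft_inr (β : List G₂.NT) : projLeft (inr (G₁ := G₁) β) = [] := by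
  simp [projLeft, List.filterMap_map, Function.comp_def]

theorem projRight_append (δ ε : List (Option (G₁.NT ⊕ G₂.NT))) :
    projRight (δ ++ ε) = projRight δ ++ projRight ε :=
  List.filterMap_append

theorem projRight_inl (α : List G₁.NT) : projRight (inl (G₂ := G₂) α) = [] := by
  simp [projRight, List.filterMap_map, Function.comp_def]

theorem projRight_inr (β : List G₂.NT) : projRight (inr (G₁ := G₁) β) = β := by
  simp [projRight, List.filterMap_map, Function.comp_def]

/-- In the shuffle of two grammars, non-terminals of different grammars are independent. -/
def ShuffleIndep (G₁ G₂ : Grammar T) : Option (G₁.NT ⊕ G₂.NT) → Option (G₁.NT ⊕ G₂.NT) → Prop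
  | some (.inl X), some (.inl Y) => G₁.Indep X Y
  | some (.inr X), some (.inr Y) => G₂.Indep X Y
  | none, none => False
  | _, _ => True

/-- A grammar for the shuffle of the languages of two grammars. The new initial non-terminal `none`
has the productions of the configuration that consists of the two initial non-terminals. -/
abbrev shuffle (G₁ G₂ : Grammar T) : Grammar T where
  NT := Option (G₁.NT ⊕ G₂.NT)
  finite_NT := by
    have := G₁.finite_NT
    have := G₂.finite_NT
    infer_instance
  initial := none
  productions :=
    ((fun p => (some (.inl p.1), p.2.1, inl p.2.2)) '' G₁.productions) ∪
    ((fun p => (some (.inr p.1), p.2.1, inr p.2.2)) '' G₂.productions) ∪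
    ((fun p => (none, p.2.1, inl p.2.2 ++ inr [G₂.initial])) ''
      {p ∈ G₁.productions | p.1 = G₁.initial}) ∪
    ((fun p => (none, p.2.1, inl [G₁.initial] ++ inr p.2.2)) ''
      {p ∈ G₂.productions | p.1 = G₂.initial})
  finite_productions :=
    have h₁ := G₁.finite_productions
    have h₂ := G₂.finite_productions
    (((h₁.image _).union (h₂.image _)).union ((h₁.sep _).image _)).union ((h₂.sep _).image _)
  Indep := ShuffleIndep G₁ G₂
  indep_symm := by
    rintro (_ | X | X) (_ | Y | Y) h
    exacts [h, h, h, h, G₁.indep_symm _ _ h, h, h, h, G₂.indep_symm _ _ h]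
  indep_irrefl := by
    rintro (_ | X | X) h
    exacts [h, G₁.indep_irrefl X h, G₂.indep_irrefl X h]

theorem Derives.exists_interleaving {δ ε : List (shuffle G₁ G₂).NT} {w : List T}
    (h : (shuffle G₁ G₂).Derives δ w ε) (hδ : none ∉ δ) :
    ∃ w₁ w₂, Interleaving w₁ w₂ w ∧ G₁.Derives (projLeft δ) w₁ (projLeft ε) ∧
      G₂.Derives (projRight δ) w₂ (projRight ε) := by
  induction h with
  | refl δ => exact ⟨[], [], .nil, .refl _, .refl _⟩
  | @production Z a γ β _ _ hp _ ih =>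
    obtain ((⟨⟨X, a, γ⟩, hp, ⟨⟩⟩ | ⟨⟨Y, a, γ⟩, hp, ⟨⟩⟩) | ⟨_, _, ⟨⟩⟩) | ⟨_, _, ⟨⟩⟩ := hp
    · obtain ⟨w₁, w₂, hw, h₁, h₂⟩ := ih (by simpa using hδ)
      simp only [projLeft_append, projRight_append, projLeft_inl, projRight_inl] at h₁ h₂
      exact ⟨_, _, hw.left a, .production hp h₁, h₂⟩
    · obtain ⟨w₁, w₂, hw, h₁, h₂⟩ := ih (by simpa using hδ)
      simp only [projLeft_append, projRight_append, projLeft_inr, projRight_inr] at h₁ h₂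
      exact ⟨_, _, hw.right a, h₁, .production hp h₂⟩
    all_goals simp at hδ
  | @swap X Y α β _ _ hXY _ ih =>
    have hperm : (α ++ X :: Y :: β).Perm (α ++ Y :: X :: β) := (List.Perm.swap ..).append_left α
    obtain ⟨w₁, w₂, hw, h₁, h₂⟩ := ih (mt hperm.mem_iff.2 hδ)
    have hswap : (shuffle G₁ G₂).Derives (α ++ X :: Y :: β) [] (α ++ Y :: X :: β) :=
      .swap hXY (.refl _)
    refine ⟨w₁, w₂, hw, (hswap.filterMap ?_).trans h₁, (hswap.filterMap ?_).trans h₂⟩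
    · rintro (_ | X | X) (_ | Y | Y) h _ ⟨⟩ _ ⟨⟩
      exact h
    · rintro (_ | X | X) (_ | Y | Y) h _ ⟨⟩ _ ⟨⟩
      exact h

theorem Derives.inl {α β : List G₁.NT} (h : G₁.Derives α [] β) :
    (shuffle G₁ G₂).Derives (inl α) [] (inl β) := by
  simpa only [List.filterMap_eq_map] using
    h.filterMap (H := shuffle G₁ G₂) (f := some ∘ fun X => some (.inl X)) (by
      rintro X Y h _ ⟨⟩ _ ⟨⟩; exact h)

theorem Derives.inr {α β : List G₂.NT} (h : G₂.Derives α [] β) :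
    (shuffle G₁ G₂).Derives (inr α) [] (inr β) := by
  simpa only [List.filterMap_eq_map] using
    h.filterMap (H := shuffle G₁ G₂) (f := some ∘ fun X => some (.inr X)) (by
      rintro X Y h _ ⟨⟩ _ ⟨⟩; exact h)

theorem indep_of_mem_inl_of_mem_inr {α : List G₁.NT} {β : List G₂.NT} {X Y : (shuffle G₁ G₂).NT}
    (hX : X ∈ inl (G₂ := G₂) α) (hY : Y ∈ inr (G₁ := G₁) β) : (shuffle G₁ G₂).Indep X Y := by
  obtain ⟨X, -, rfl⟩ := List.mem_map.1 hX
  obtain ⟨Y, -, rfl⟩ := List.mem_map.1 hY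
  trivial

theorem derives_inl_append_inr_comm (α : List G₁.NT) (β : List G₂.NT) :
    (shuffle G₁ G₂).Derives (inl α ++ inr β) [] (inr β ++ inl α) :=
  derives_append_comm fun _ hX _ hY => indep_of_mem_inl_of_mem_inr hX hY

theorem derives_inr_append_inl_comm (α : List G₁.NT) (β : List G₂.NT) :
    (shuffle G₁ G₂).Derives (inr β ++ inl α) [] (inl α ++ inr β) :=
  derives_append_comm fun _ hY _ hX => indep_symm _ _ _ (indep_of_mem_inl_of_mem_inr hX hY)

theorem derives_inl_append_inr {w₁ w₂ w : List T} (hw : Interleaving w₁ w₂ w) {α : List G₁.NT}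
    {β : List G₂.NT} (h₁ : G₁.Derives α w₁ []) (h₂ : G₂.Derives β w₂ []) :
    (shuffle G₁ G₂).Derives (inl α ++ inr β) w [] := by
  induction hw generalizing α β with
  | nil =>
    obtain rfl := h₁.perm.eq_nil
    obtain rfl := h₂.perm.eq_nil
    exact .refl _
  | left a _ ih =>
    obtain ⟨X, α', γ, hX, hp, hγ⟩ := derives_cons_iff.1 h₁
    refine derives_cons_iff.2 ⟨some (.inl X), inl α' ++ inr β, inl γ, ?_, ?_, ?_⟩
    · exact hX.inl.append_right _
    · exact .inl (.inl (.inl ⟨_, hp, rfl⟩))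
    · simpa using ih hγ h₂
  | right a _ ih =>
    obtain ⟨Y, β', γ, hY, hp, hγ⟩ := derives_cons_iff.1 h₂
    refine derives_cons_iff.2 ⟨some (.inr Y), inr β' ++ inl α, inr γ, ?_, ?_, ?_⟩
    · exact (derives_inl_append_inr_comm α β).trans (hY.inr.append_right (inl α))
    · exact .inl (.inl (.inr ⟨_, hp, rfl⟩))
    · simpa using (derives_inr_append_inl_comm α (γ ++ β')).trans (ih h₁ hγ)

theorem language_shuffle (G₁ G₂ : Grammar T) :
    (shuffle G₁ G₂).language = PartiallyCommutative.shuffle G₁.language G₂.language := by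
  ext w
  constructor
  · intro h
    obtain ⟨a, γ, u, hp, hu, rfl⟩ := derives_singleton_nil_iff.1 h
    obtain ((⟨_, _, ⟨⟩⟩ | ⟨_, _, ⟨⟩⟩) | ⟨⟨_, a, γ⟩, ⟨hp, rfl⟩, ⟨⟩⟩) |
      ⟨⟨_, a, γ⟩, ⟨hp, rfl⟩, ⟨⟩⟩ := hp
    all_goals
      obtain ⟨w₁, w₂, hw, h₁, h₂⟩ := hu.exists_interleaving (by simp)
      simp only [projLeft_append, projRight_append, projLeft_inl, projLeft_inr, projRight_inl,
        projRight_inr, List.append_nil, List.nil_append] at h₁ h₂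
    · exact ⟨_, derives_singleton_nil_iff.2 ⟨a, γ, w₁, hp, h₁, rfl⟩, w₂, h₂, hw.left a⟩
    · exact ⟨w₁, h₁, _, derives_singleton_nil_iff.2 ⟨a, γ, w₂, hp, h₂, rfl⟩, hw.right a⟩
  · rintro ⟨w₁, h₁, w₂, h₂, hw⟩
    obtain ⟨a, γ₁, u₁, hp₁, hu₁, rfl⟩ := derives_singleton_nil_iff.1 h₁
    obtain ⟨b, γ₂, u₂, hp₂, hu₂, rfl⟩ := derives_singleton_nil_iff.1 h₂
    cases hw with
    | left _ hw =>
      exact derives_singleton_nil_iff.2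
        ⟨a, _, _, .inl (.inr ⟨_, ⟨hp₁, rfl⟩, rfl⟩), derives_inl_append_inr hw hu₁ h₂, rfl⟩
    | right _ hw =>
      exact derives_singleton_nil_iff.2
        ⟨b, _, _, .inr ⟨_, ⟨hp₂, rfl⟩, rfl⟩, derives_inl_append_inr hw h₁ hu₂, rfl⟩

end Grammar

theorem shuffle_mem_TrPCCFL {T : Type} {L₁ L₂ : Language T} (h₁ : L₁ ∈ TrPCCFL T)
    (h₂ : L₂ ∈ TrPCCFL T) : shuffle L₁ L₂ ∈ TrPCCFL T := by
  obtain ⟨G₁, h₁, rfl⟩ := h₁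
  obtain ⟨G₂, h₂, rfl⟩ := h₂
  refine ⟨G₁.shuffle G₂, ?_, Grammar.language_shuffle G₁ G₂⟩
  rintro (_ | X | X) (_ | Y | Y) (_ | Z | Z) hXY hYZ
  all_goals first
    | exact id
    | exact h₁ X Y Z hXY hYZ
    | exact h₂ X Y Z hXY hYZ
    | exact (hXY trivial).elim
    | exact (hYZ trivial).elim

/-! ### Context-free languages -/

theorem mem_prod_map_singleton {T : Type*} {l w : List T} :
    w ∈ (l.map fun t => ({[t]} : Language T)).prod ↔ w = l := by
  induction l generalizing w with
  | nil => exact Iff.rfl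
  | cons t l ih =>
    rw [List.map_cons, List.prod_cons, Language.mem_mul]
    constructor
    · rintro ⟨_, rfl, u, hu, rfl⟩
      rw [ih.1 hu]
      rfl
    · rintro rfl
      exact ⟨[t], rfl, l, ih.2 rfl, rfl⟩

theorem prod_map_le_of_derives {T : Type*} {g : ContextFreeGrammar T}
    {K : Symbol T g.NT → Language T}
    (hK : ∀ r ∈ g.rules, (r.output.map K).prod ≤ K (.nonterminal r.input))
    {s s' : List (Symbol T g.NT)} (h : g.Derives s s') : (s'.map K).prod ≤ (s.map K).prod := by
  induction h with
  | refl => exact le_rfl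
  | tail _ h ih =>
    refine le_trans ?_ ih
    obtain ⟨r, hr, h⟩ := h
    obtain ⟨p, q, rfl, rfl⟩ := h.exists_parts
    simp only [List.map_append, List.prod_append, List.map_singleton, List.prod_singleton]
    exact mul_le_mul' (mul_le_mul' le_rfl (hK r hr)) le_rfl

namespace Grammar

variable {T : Type} {G : Grammar T}

/-- The words that a single non-terminal emits in derivations without swaps. -/
def languageOf (G : Grammar T) (X : G.NT) : Language T := {w | G.Yields [X] w}

theorem yields_iff_mem_prod {α : List G.NT} {w : List T} :
    G.Yields α w ↔ w ∈ (α.map G.languageOf).prod := by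
  induction α generalizing w with
  | nil => exact yields_nil_iff
  | cons X α ih =>
    rw [yields_cons_iff, List.map_cons, List.prod_cons, Language.mem_mul]
    simp only [ih]
    exact ⟨fun ⟨u, v, hu, hv, h⟩ => ⟨u, hu, v, hv, h.symm⟩,
      fun ⟨u, hu, v, hv, h⟩ => ⟨u, v, hu, hv, h.symm⟩⟩

/-- The context-free grammar with the productions of `G`, which forgets the independence. -/
noncomputable abbrev toContextFreeGrammar (G : Grammar T) : ContextFreeGrammar T where
  NT := G.NT
  initial := G.initial
  rules := (G.finite_productions.image fun p =>
    (⟨p.1, .terminal p.2.1 :: p.2.2.map .nonterminal⟩ : ContextFreeRule T G.NT)).toFinset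

theorem Yields.contextFree_derives {α : List G.NT} {w : List T} (h : G.Yields α w) :
    G.toContextFreeGrammar.Derives (α.map .nonterminal) (w.map .terminal) := by
  induction h with
  | nil => exact .refl _
  | @cons X a γ β u v hp _ _ ihγ ihβ =>
    have hX : G.toContextFreeGrammar.Produces [.nonterminal X]
        (.terminal a :: γ.map .nonterminal) :=
      ⟨_, (Set.Finite.mem_toFinset _).2 ⟨_, hp, rfl⟩, ContextFreeRule.Rewrites.input_output⟩
    have hXu := (hX.single.trans (ihγ.append_left [.terminal a])).append_right (β.map .nonterminal)
    have hβv := ihβ.append_left (.terminal a :: u.map .terminal)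
    simpa using hXu.trans hβv

theorem yields_of_contextFree_derives {X : G.NT} {w : List T}
    (h : G.toContextFreeGrammar.Derives [.nonterminal X] (w.map .terminal)) : G.Yields [X] w := by
  let K : Symbol T G.NT → Language T
    | .terminal t => {[t]}
    | .nonterminal X => G.languageOf X
  have hK : ∀ r ∈ G.toContextFreeGrammar.rules,
      (r.output.map K).prod ≤ K (.nonterminal r.input) := by
    intro r hr
    obtain ⟨⟨Y, a, γ⟩, hp, rfl⟩ := (Set.Finite.mem_toFinset _).1 hr
    rw [List.map_cons, List.map_map, List.prod_cons]
    rintro _ ⟨_, rfl, u, hu, rfl⟩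
    exact yields_singleton_iff.2 ⟨a, γ, u, hp, yields_iff_mem_prod.2 hu, rfl⟩
  have hw : w ∈ ((w.map Symbol.terminal).map K).prod := by
    rw [List.map_map]
    exact mem_prod_map_singleton.2 rfl
  have hX := prod_map_le_of_derives hK h hw
  rwa [List.map_singleton, List.prod_singleton] at hX

theorem isContextFree_language (hG : ∀ X Y, ¬ G.Indep X Y) : G.language.IsContextFree := by
  refine ⟨G.toContextFreeGrammar, ?_⟩
  ext w
  exact ⟨fun h => (yields_of_contextFree_derives h).derives,
    fun h => ((derives_nil_iff_yields hG).1 h).contextFree_derives⟩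

end Grammar

/-! ### Words with a matching pair of blocks -/

section Blocks

variable {T : Type}

/-- The words `p xⁿ z yⁿ τ` with `n ≥ 1`. -/
def blockLanguage (p x z y : T) (τ : List T) : Language T :=
  {w | ∃ n, 1 ≤ n ∧ w = p :: (List.replicate n x ++ z :: List.replicate n y ++ τ)}

/-- The non-terminals of a grammar for `blockLanguage p x z y τ`: the initial one, one for the words
`xⁿ z yⁿ`, and one for each letter. -/
inductive BlockNT (T : Type)
  | start
  | core
  | letter (t : T)

instance [Finite T] : Finite (BlockNT T) := by
  refine .of_surjective (fun X : Option (Option T) => match X with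
    | none => .start
    | some none => .core
    | some (some t) => .letter t) ?_
  rintro (_ | _ | t)
  exacts [⟨none, rfl⟩, ⟨some none, rfl⟩, ⟨some (some t), rfl⟩]

/-- A grammar for `blockLanguage p x z y τ`, without any commutation. -/
abbrev blockGrammar [Finite T] (p x z y : T) (τ : List T) : Grammar T where
  NT := BlockNT T
  finite_NT := inferInstance
  initial := .start
  productions :=
    {(.start, p, .core :: τ.map .letter), (.core, x, [.core, .letter y]),
      (.core, x, [.letter z, .letter y])} ∪ Set.range fun t => (.letter t, t, [])
  finite_productions := Set.toFinite _
  Indep _ _ := False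
  indep_symm _ _ := id
  indep_irrefl _ := id

variable {p x z y : T} {τ : List T}

theorem yields_map_letter [Finite T] (σ : List T) :
    (blockGrammar p x z y τ).Yields (σ.map BlockNT.letter) σ := by
  induction σ with
  | nil => exact .nil
  | cons t σ ih => exact .cons (G := blockGrammar p x z y τ) (.inr ⟨t, rfl⟩) .nil ih

theorem yields_core [Finite T] (n : ℕ) : (blockGrammar p x z y τ).Yields [BlockNT.core]
    (List.replicate (n + 1) x ++ z :: List.replicate (n + 1) y) := by
  induction n with
  | zero =>
    have hturn := Grammar.Yields.cons (G := blockGrammar p x z y τ) (.inl (.inr (.inr rfl)))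
      (yields_map_letter [z, y]) .nil
    simpa using hturn
  | succ n ih =>
    have hstep := Grammar.Yields.cons (G := blockGrammar p x z y τ) (.inl (.inr (.inl rfl)))
      (ih.append (yields_map_letter [y])) .nil
    rw [List.replicate_succ (n := n + 1), List.replicate_succ' (n := n + 1) (a := y)]
    simpa using hstep

theorem language_blockGrammar [Finite T] :
    (blockGrammar p x z y τ).language = blockLanguage p x z y τ := by
  ext w
  refine (Grammar.derives_nil_iff_yields fun _ _ => id).trans ⟨fun h => ?_, ?_⟩
  · let K : BlockNT T → Language T
      | .start => blockLanguage p x z y τ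
      | .core => {w | ∃ n, 1 ≤ n ∧ w = List.replicate n x ++ z :: List.replicate n y}
      | .letter t => {[t]}
    have hw := h.mem_prod K ?_
    · simpa using hw
    rintro X t γ ((⟨⟨⟩⟩ | ⟨⟨⟩⟩ | ⟨⟨⟩⟩) | ⟨t, ⟨⟩⟩) u hu
    · obtain ⟨_, ⟨n, hn, rfl⟩, v, hv, rfl⟩ := hu
      rw [List.map_map] at hv
      obtain rfl := mem_prod_map_singleton.1 hv
      exact ⟨n, hn, rfl⟩
    · obtain ⟨_, ⟨n, hn, rfl⟩, _, ⟨_, rfl, _, rfl, rfl⟩, rfl⟩ := hu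
      refine ⟨n + 1, by omega, ?_⟩
      rw [List.replicate_succ, List.replicate_succ' (a := y)]
      simp
    · obtain ⟨_, rfl, _, ⟨_, rfl, _, rfl, rfl⟩, rfl⟩ := hu
      exact ⟨1, le_rfl, rfl⟩
    · obtain rfl : u = [] := hu
      rfl
  · rintro ⟨n, hn, rfl⟩
    obtain ⟨n, rfl⟩ := Nat.exists_eq_add_of_le' hn
    have hstart := Grammar.Yields.cons (G := blockGrammar p x z y τ) (.inl (.inl rfl))
      ((yields_core n).append (yields_map_letter τ)) .nil
    simpa using hstart

theorem blockLanguage_mem_TrPCCFL [Finite T] (p x z y : T) (τ : List T) :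
    blockLanguage p x z y τ ∈ TrPCCFL T :=
  ⟨blockGrammar p x z y τ, fun _ _ _ _ _ => id, language_blockGrammar⟩

theorem isContextFree_blockLanguage [Finite T] (p x z y : T) (τ : List T) :
    (blockLanguage p x z y τ).IsContextFree := by
  rw [← language_blockGrammar]
  exact Grammar.isContextFree_language fun _ _ => id

end Blocks

instance : Finite Src := by
  refine .of_surjective ![Src.a, .s, .b, .t, .c] ?_
  rintro ⟨⟩
  exacts [⟨0, rfl⟩, ⟨1, rfl⟩, ⟨2, rfl⟩, ⟨3, rfl⟩, ⟨4, rfl⟩]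

instance : Finite Tgt := by
  refine .of_surjective ![Tgt.A, .S₁, .B₁, .T₁, .S₂, .B₂, .T₂, .C] ?_
  rintro ⟨⟩
  exacts [⟨0, rfl⟩, ⟨1, rfl⟩, ⟨2, rfl⟩, ⟨3, rfl⟩, ⟨4, rfl⟩, ⟨5, rfl⟩, ⟨6, rfl⟩, ⟨7, rfl⟩]

theorem lang₁_eq_blockLanguage : lang₁ = blockLanguage .A .A .S₁ .B₁ [.T₁] := by
  simp only [lang₁, blockLanguage, List.replicate_succ, List.append_assoc, List.cons_append,
    List.nil_append]
  rfl

theorem lang₂_eq_blockLanguage : lang₂ = blockLanguage .S₂ .B₂ .T₂ .C [] := by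
  simp only [lang₂, blockLanguage, List.append_assoc, List.cons_append, List.nil_append,
    List.append_nil]
  rfl

theorem isContextFree_lang₁ : lang₁.IsContextFree :=
  lang₁_eq_blockLanguage ▸ isContextFree_blockLanguage ..

theorem isContextFree_lang₂ : lang₂.IsContextFree :=
  lang₂_eq_blockLanguage ▸ isContextFree_blockLanguage ..

theorem shuffle_lang_mem_TrPCCFL : shuffle lang₁ lang₂ ∈ TrPCCFL Tgt := by
  rw [lang₁_eq_blockLanguage, lang₂_eq_blockLanguage]
  exact shuffle_mem_TrPCCFL (blockLanguage_mem_TrPCCFL ..) (blockLanguage_mem_TrPCCFL ..)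

/-! ### The inverse image of the shuffle -/

theorem interleaving_filter {T : Type} (P : T → Bool) (u : List T) :
    Interleaving (u.filter P) (u.filter fun t => !P t) u := by
  induction u with
  | nil => exact .nil
  | cons t u ih =>
    by_cases h : P t
    · simpa [h] using ih.left t
    · simpa [h] using ih.right t

theorem Interleaving.eq_filter {T : Type} {P : T → Bool} {w v u : List T}
    (h : Interleaving w v u) (hw : ∀ t ∈ w, P t) (hv : ∀ t ∈ v, P t = false) :
    w = u.filter P ∧ v = u.filter fun t => !P t := by
  induction h with
  | nil => exact ⟨rfl, rfl⟩
  | left t _ ih =>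
    obtain ⟨ht, hw⟩ := List.forall_mem_cons.1 hw
    simpa [ht] using ih hw hv
  | right t _ ih =>
    obtain ⟨ht, hv⟩ := List.forall_mem_cons.1 hv
    simpa [ht] using ih hw hv

theorem mem_shuffle_iff_filter {T : Type} {P : T → Bool} {L K : Language T}
    (hL : ∀ w ∈ L, ∀ t ∈ w, P t) (hK : ∀ v ∈ K, ∀ t ∈ v, P t = false) {u : List T} :
    u ∈ shuffle L K ↔ u.filter P ∈ L ∧ (u.filter fun t => !P t) ∈ K := by
  constructor
  · rintro ⟨w, hw, v, hv, h⟩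
    obtain ⟨rfl, rfl⟩ := h.eq_filter (hL w hw) (hK v hv)
    exact ⟨hw, hv⟩
  · rintro ⟨hw, hv⟩
    exact ⟨_, hw, _, hv, interleaving_filter P u⟩

theorem exists_append_cons_of_filterMap_eq {α β : Type*} {f : α → Option β} {x : α} {y : β}
    (hf : ∀ z, f z = some y → z = x) {w : List α} {u v : List β}
    (h : w.filterMap f = u ++ y :: v) :
    ∃ w₁ w₂, w = w₁ ++ x :: w₂ ∧ w₁.filterMap f = u ∧ w₂.filterMap f = v := by
  obtain ⟨w₁, _, rfl, rfl, hv⟩ := List.filterMap_eq_append_iff.1 h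
  obtain ⟨w₂, z, w₃, rfl, hnone, hz, rfl⟩ := List.filterMap_eq_cons_iff.1 hv
  obtain rfl := hf z hz
  refine ⟨w₁ ++ w₂, w₃, by simp, ?_, rfl⟩
  rw [List.filterMap_append, List.filterMap_eq_nil_iff.2 hnone, List.append_nil]

theorem eq_replicate_of_filterMap_eq {α β : Type*} {f : α → Option β} {x : α} {y : β}
    (hf : f x = some y) {w : List α} (hw : ∀ z ∈ w, z = x) {n : ℕ}
    (h : w.filterMap f = List.replicate n y) : w = List.replicate n x := by
  have hlen := List.eq_replicate_of_mem hw
  rw [hlen, List.filterMap_replicate_of_some hf] at h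
  rwa [List.replicate_left_injective y h] at hlen

/-- The letters of `lang₁`. -/
def Tgt.isFirst : Tgt → Bool
  | .A | .S₁ | .B₁ | .T₁ => true
  | _ => false

/-- The letter of `lang₁` in the image of a letter under `hom`. -/
def Src.first : Src → Option Tgt
  | .a => some .A
  | .s => some .S₁
  | .b => some .B₁
  | .t => some .T₁
  | .c => none

/-- The letter of `lang₂` in the image of a letter under `hom`. -/
def Src.second : Src → Option Tgt
  | .a => none
  | .s => some .S₂
  | .b => some .B₂
  | .t => some .T₂
  | .c => some .C

theorem Src.eq_c_of_first_eq_none {x : Src} (h : x.first = none) : x = .c := by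
  cases x <;> first | rfl | cases h

theorem Src.eq_a_of_second_eq_none {x : Src} (h : x.second = none) : x = .a := by
  cases x <;> first | rfl | cases h

theorem filter_isFirst_flatMap_hom (w : List Src) :
    (w.flatMap hom).filter Tgt.isFirst = w.filterMap Src.first := by
  induction w with
  | nil => rfl
  | cons x w ih => cases x <;> first | exact ih | exact congrArg (_ :: ·) ih

theorem filter_not_isFirst_flatMap_hom (w : List Src) :
    ((w.flatMap hom).filter fun t => !t.isFirst) = w.filterMap Src.second := by
  induction w with
  | nil => rfl
  | cons x w ih => cases x <;> first | exact ih | exact congrArg (_ :: ·) ih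

theorem mem_inverseImage_hom_shuffle {w : List Src} :
    w ∈ inverseImage hom (shuffle lang₁ lang₂) ↔
      w.filterMap Src.first ∈ lang₁ ∧ w.filterMap Src.second ∈ lang₂ := by
  rw [← filter_isFirst_flatMap_hom, ← filter_not_isFirst_flatMap_hom]
  refine mem_shuffle_iff_filter ?_ ?_
  · rintro _ ⟨m, -, rfl⟩
    simp [or_imp, forall_and, Tgt.isFirst, List.mem_replicate]
  · rintro _ ⟨n, -, rfl⟩
    simp [or_imp, forall_and, Tgt.isFirst, List.mem_replicate]

/-- In front of the letter `s` only the first projection emits letters, behind the letter `t` only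
the second one, and in between both count the letters `b`. -/
theorem eq_of_filterMap_first_of_filterMap_second {w : List Src} {k m n l : ℕ}
    (h₁ : w.filterMap Src.first =
      List.replicate k .A ++ .S₁ :: (List.replicate m .B₁ ++ [.T₁]))
    (h₂ : w.filterMap Src.second = .S₂ :: (List.replicate n .B₂ ++ .T₂ :: List.replicate l .C)) :
    m = n ∧
      w = List.replicate k .a ++ .s :: (List.replicate m .b ++ .t :: List.replicate l .c) := by
  obtain ⟨p, w, rfl, hp₁, h₁⟩ := exists_append_cons_of_filterMap_eq (x := .s)
    (by rintro ⟨⟩ ⟨⟩; rfl) h₁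
  obtain ⟨q, r, rfl, hq₁, hr₁⟩ := exists_append_cons_of_filterMap_eq (x := .t)
    (by rintro ⟨⟩ ⟨⟩; rfl) h₁
  simp only [List.filterMap_append, List.filterMap_cons, Src.second] at h₂
  obtain ⟨hp₂, -, h₂⟩ := (List.append_cons_inj_of_notMem (x₁ := []) (by simp)
    (by simp [List.mem_replicate])).1 h₂.symm
  obtain ⟨hq₂, -, hr₂⟩ := (List.append_cons_inj_of_notMem (by simp [List.mem_replicate])
    (by simp [List.mem_replicate])).1 h₂
  have hp : ∀ x ∈ p, x = .a := fun x hx =>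
    Src.eq_a_of_second_eq_none (List.filterMap_eq_nil_iff.1 hp₂.symm x hx)
  have hr : ∀ x ∈ r, x = .c := fun x hx =>
    Src.eq_c_of_first_eq_none (List.filterMap_eq_nil_iff.1 hr₁ x hx)
  have hq : ∀ x ∈ q, x = .b := fun x hx => by
    have hfirst (y) (hy : x.first = some y) : y = .B₁ :=
      List.eq_of_mem_replicate (hq₁ ▸ List.mem_filterMap.2 ⟨x, hx, hy⟩)
    have hsecond (y) (hy : x.second = some y) : y = .B₂ :=
      List.eq_of_mem_replicate (hq₂ ▸ List.mem_filterMap.2 ⟨x, hx, hy⟩)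
    cases x <;> first | rfl | cases hfirst _ rfl | cases hsecond _ rfl
  obtain rfl := eq_replicate_of_filterMap_eq (f := Src.first) rfl hp hp₁
  obtain rfl := eq_replicate_of_filterMap_eq (f := Src.second) rfl hr hr₂.symm
  obtain rfl := eq_replicate_of_filterMap_eq (f := Src.first) rfl hq hq₁
  exact ⟨by simpa [List.filterMap_replicate, Src.second] using congrArg List.length hq₂.symm, rfl⟩

theorem inverseImage_hom_shuffle : inverseImage hom (shuffle lang₁ lang₂) =
    {w | ∃ n : ℕ, 1 ≤ n ∧ w = List.replicate (n + 1) Src.a ++ [Src.s] ++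
      List.replicate n Src.b ++ [Src.t] ++ List.replicate n Src.c} := by
  ext w
  rw [mem_inverseImage_hom_shuffle]
  constructor
  · rintro ⟨⟨m, hm, h₁⟩, n, hn, h₂⟩
    obtain ⟨rfl, rfl⟩ :=
      eq_of_filterMap_first_of_filterMap_second (by simpa using h₁) (by simpa using h₂)
    exact ⟨m, hm, by simp⟩
  · rintro ⟨n, hn, rfl⟩
    refine ⟨⟨n, hn, ?_⟩, n, hn, ?_⟩
    · simp [Src.first, List.filterMap_append, List.filterMap_replicate]
    · simp [Src.second, List.filterMap_append, List.filterMap_replicate]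

/-- Letters are ordered as they are declared: `a < s < b < t < c`. -/
instance : PartialOrder Src :=
  PartialOrder.lift Src.ctorIdx (by rintro ⟨⟩ ⟨⟩ <;> simp [Src.ctorIdx])

theorem inverseImage_hom_shuffle_notMem_PCCFL :
    inverseImage hom (shuffle lang₁ lang₂) ∉ PCCFL Src := by
  classical
  rw [inverseImage_hom_shuffle]
  refine notMem_PCCFL_of_pairwise (r := (· ≤ ·)) (S := {.a, .b, .c}) ?_ (by simp) ?_ fun n => ?_
  · rintro _ ⟨n, -, rfl⟩
    have hle (x y : Src) : x ≤ y ↔ x.ctorIdx ≤ y.ctorIdx := .rfl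
    simp [List.pairwise_append, List.pairwise_replicate, List.mem_replicate, or_imp, forall_and,
      hle, Src.ctorIdx]
  · intro x hx _ ⟨m, _, hv⟩ _ ⟨n, _, hw⟩ h
    obtain rfl : m = n := by
      simp only [Finset.mem_insert, Finset.mem_singleton] at hx
      obtain rfl | rfl | rfl := hx <;>
        simpa [hv, hw, List.count_append, List.count_replicate] using h
    rw [hv, hw]
  · exact ⟨_, ⟨n + 1, by omega, rfl⟩, by simp; omega⟩

/-! ### Failure of closure -/

theorem not_closedUnderInterRegular {C : (T : Type) → Set (Language T)} (hC : C ABC ⊆ PCCFL ABC)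
    (h : equalCounts ∈ C ABC) : ¬ ClosedUnderInterRegular C := fun hclosed =>
  equalCounts_inf_aStarBStarCStar_notMem_PCCFL
    (hC (hclosed ABC _ _ h isRegular_aStarBStarCStar))

theorem not_closedUnderInverseHom {C : (T : Type) → Set (Language T)} (hC : C Src ⊆ PCCFL Src)
    (h : shuffle lang₁ lang₂ ∈ C Tgt) : ¬ ClosedUnderInverseHom C := fun hclosed =>
  inverseImage_hom_shuffle_notMem_PCCFL
    (hC (hclosed Src Tgt hom (by rintro ⟨⟩ <;> exact List.cons_ne_nil _ _) _ h))

end PartiallyCommutative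

open PartiallyCommutative in
theorem mainTheorem9 :
    -- neither class is closed under intersection with regular languages
    (¬ ClosedUnderInterRegular PCCFL ∧ ¬ ClosedUnderInterRegular TrPCCFL) ∧
    -- the witness for the failure
    (equalCounts ∈ CCFL ABC ∧ equalCounts ∈ TrPCCFL ABC ∧ equalCounts ∈ PCCFL ABC ∧
      aStarBStarCStar.IsRegular ∧
      equalCounts ⊓ aStarBStarCStar =
        {w | ∃ n : ℕ, 1 ≤ n ∧ w = List.replicate n ABC.a ++ List.replicate n ABC.b ++
          List.replicate n ABC.c} ∧
      equalCounts ⊓ aStarBStarCStar ∉ PCCFL ABC) ∧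
    -- neither class is closed under inverse homomorphic images
    (¬ ClosedUnderInverseHom PCCFL ∧ ¬ ClosedUnderInverseHom TrPCCFL) ∧
    -- the witness for the failure: a shuffle of two context-free languages
    (lang₁.IsContextFree ∧ lang₂.IsContextFree ∧
      shuffle lang₁ lang₂ ∈ TrPCCFL Tgt ∧ shuffle lang₁ lang₂ ∈ PCCFL Tgt ∧
      inverseImage hom (shuffle lang₁ lang₂) =
        {w | ∃ n : ℕ, 1 ≤ n ∧ w = List.replicate (n + 1) Src.a ++ [Src.s] ++
          List.replicate n Src.b ++ [Src.t] ++ List.replicate n Src.c} ∧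
      inverseImage hom (shuffle lang₁ lang₂) ∉ PCCFL Src) := by
  have hTr := CCFL_subset_TrPCCFL equalCounts_mem_CCFL
  have hPC := TrPCCFL_subset_PCCFL hTr
  have hshuffle := TrPCCFL_subset_PCCFL shuffle_lang_mem_TrPCCFL
  exact ⟨⟨not_closedUnderInterRegular subset_rfl hPC,
      not_closedUnderInterRegular TrPCCFL_subset_PCCFL hTr⟩,
    ⟨equalCounts_mem_CCFL, hTr, hPC, isRegular_aStarBStarCStar, equalCounts_inf_aStarBStarCStar,
      equalCounts_inf_aStarBStarCStar_notMem_PCCFL⟩,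
    ⟨not_closedUnderInverseHom subset_rfl hshuffle,
      not_closedUnderInverseHom TrPCCFL_subset_PCCFL shuffle_lang_mem_TrPCCFL⟩,
    isContextFree_lang₁, isContextFree_lang₂, shuffle_lang_mem_TrPCCFL, hshuffle,
    inverseImage_hom_shuffle, inverseImage_hom_shuffle_notMem_PCCFL⟩
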